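/- **Theorem 2.4.** For $s\ge 0$ and complex coefficients $a_1,\dots,a_s$ and $b_0,\dots,b_s$, consider the splitting method $$\Psi(h)=e^{hb_0B}\,e^{ha_1A}\,e^{hb_1B}\cdots e^{ha_sA}\,e^{hb_sB}.$$ It is said to be of order $p$ if, for arbitrary non-commuting $A$ and $B$, its formal expansion in powers of $h$ satisfies $$\Psi(h)-e^{h(A+B)}=h^{p+1}E_{p+1}+h^{p+2}E_{p+2}+\cdots,$$ that is, if the coefficients of $h^0,\dots,h^p$ in $\Psi(h)-e^{h(A+B)}$ vanish, as an identity of formal power series in $h$ over the free associative algebra $\mathbb{C}\langle A,B\rangle$. Then splitting methods with $\operatorname{Re}(a_i)\ge 0$ for all $i$ exist at least up to order $44$: for every integer $p$ with $1\le p\le 44$ there are $s$, complex numbers $a_1,\dots,a_s$ with $\operatorname{Re}(a_i)\ge 0$ for all $i$, and complex numbers $b_0,\dots,b_s$ such that the method $\Psi$ is of order $p$. -/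

import Mathlib

open scoped Nat

noncomputable section

namespace Splitting

/-- The formal exponential `e^{h x} = ∑ₖ hᵏ xᵏ / k!`, as a power series in the (central)
formal variable `h`, where `x` is an element of a (noncommutative) complex algebra. -/
def formalExp {R : Type*} [Ring R] [Algebra ℂ R] (x : R) : PowerSeries R :=
  PowerSeries.mk fun k => ((k ! : ℂ)⁻¹) • x ^ k

/-- The formal expansion in `h` of the splitting method
`Ψ(h) = e^{h b₀ B} e^{h a₁ A} e^{h b₁ B} ⋯ e^{h aₛ A} e^{h bₛ B}`,
the factors being multiplied from left to right. The coefficient `a_{i+1}` of the usual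
numbering is `a i` for `i : Fin s`; the coefficient `b_j` is `b j` for `j : Fin (s + 1)`. -/
def method {R : Type*} [Ring R] [Algebra ℂ R] {s : ℕ}
    (a : Fin s → ℂ) (b : Fin (s + 1) → ℂ) (A B : R) : PowerSeries R :=
  formalExp (b 0 • B) *
    (List.ofFn fun i : Fin s => formalExp (a i • A) * formalExp (b i.succ • B)).prod

/-- The free associative unital complex algebra on two noncommuting letters. -/
abbrev Words : Type := FreeAlgebra ℂ (Fin 2)

/-- The first free generator. -/
def letterA : Words := FreeAlgebra.ι ℂ 0

/-- The second free generator. -/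
def letterB : Words := FreeAlgebra.ι ℂ 1

/-- The splitting method with coefficients `a`, `b` is of order (at least) `p`: for arbitrary
noncommuting `A` and `B`, that is, for the two free generators, the formal expansion of
`Ψ(h) - e^{h(A+B)}` has the form `h^{p+1} E_{p+1} + h^{p+2} E_{p+2} + ⋯`. -/
def HasOrder {s : ℕ} (a : Fin s → ℂ) (b : Fin (s + 1) → ℂ) (p : ℕ) : Prop :=
  ∀ k ≤ p, PowerSeries.coeff k
    (method a b letterA letterB - formalExp (letterA + letterB)) = 0

end Splitting

end

/-!
Methods with `Re aᵢ ≥ 0` exist for every order `p ≥ 1`, even with real `aᵢ ≥ 0`: since the `bⱼ` may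
be arbitrary complex numbers, the order barriers of positive real splittings disappear.

Let `S` be the monoid generated by the flows `e^{h a A}` (`a ≥ 0`) and `e^{h b B}` (`b ∈ ℂ`) in the
units of `ℂ⟨A, B⟩⟦h⟧`. Its elements are the expansions of methods with real `aᵢ ≥ 0`. One
works inside a group of series (`lieGroup`) containing all `e^{h X}` with `X` in the span of `A` and
`B` and having the property that two members agreeing in degrees `< n` differ in degree `n` by a Lie
polynomial. The claim `Reachable n`, that each group element `g` whose `A`-component in degree `1`
is a positive real can be matched up to degree `n` by an element of `S`, is proved by induction.

For the step it suffices (`Reachable.succ`) to find, near group elements `G` of arbitrarily small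
duration, elements of `S` matching `G` up to degree `n` and having in degree `n + 1` *any*
prescribed Lie polynomial as error: multiplying a degree-`n` match of `g G⁻¹` by the right one of these gives a
match of `g` in degree `n + 1`. This property is `Flexible n (liePart (n + 1))`.

To prove it for `n ≥ 2`, take a nested bracket `z` of degree `n` in which `B` occurs `j ≥ 1` times.
By induction some `x ∈ S` satisfies `x = e^{h d A} (1 + c z hⁿ + v hⁿ⁺¹ + ⋯)`, where `v` is an
unknown Lie polynomial. The substitution `B ↦ ω B` maps `S` to itself and multiplies `z` by `ωʲ`. In the
product of the images of `x` over all `N`-th roots of unity `ω`, with `N > n + 1`, the terms from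
`z` in degree `n` and those from `v` in degree `n + 1` sum to zero. Moving the factors `1 + c ωʲ z hⁿ`
past the later flows `e^{h d A}` leaves in degree `n + 1` a nonzero multiple of `c [A, z]`, and
conjugating the factors by suitable `e^{h u B}` adds any multiple of `c [B, z]`
(`flexible_average`). These brackets span the Lie polynomials of degree `n + 1`, and flexibility is
additive (`Flexible.sup`).
-/

noncomputable section

namespace Splitting

open PowerSeries

/-! ### Low-order coefficients of products and formal exponentials -/

section Exponentials

variable {R : Type*} [Ring R]

/-- Two power series agree in all degrees strictly below `n`. -/
def Agree (n : ℕ) (f g : PowerSeries R) : Prop := ∀ k < n, coeff k f = coeff k g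

lemma Agree.refl (n : ℕ) (f : PowerSeries R) : Agree n f f := fun _ _ => rfl

lemma Agree.symm {n : ℕ} {f g : PowerSeries R} (h : Agree n f g) : Agree n g f :=
  fun k hk => (h k hk).symm

lemma Agree.trans {n : ℕ} {f g e : PowerSeries R} (h : Agree n f g) (h' : Agree n g e) :
    Agree n f e := fun k hk => (h k hk).trans (h' k hk)

lemma Agree.mono {m n : ℕ} {f g : PowerSeries R} (h : Agree n f g) (hm : m ≤ n) : Agree m f g :=
  fun k hk => h k (hk.trans_le hm)

lemma Agree.mul {n : ℕ} {f f' g g' : PowerSeries R} (h : Agree n f f') (h' : Agree n g g') :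
    Agree n (f * g) (f' * g') := by
  intro k hk
  rw [coeff_mul, coeff_mul]
  refine Finset.sum_congr rfl fun p hp => ?_
  have := Finset.HasAntidiagonal.mem_antidiagonal.1 hp
  rw [h p.1 (by omega), h' p.2 (by omega)]

lemma agree_iff_sub {n : ℕ} {f g : PowerSeries R} : Agree n f g ↔ Agree n (f - g) 0 := by
  simp [Agree, sub_eq_zero]

lemma Agree.succ {n : ℕ} {f g : PowerSeries R} (h : Agree n f g) (hn : coeff n f = coeff n g) :
    Agree (n + 1) f g := by
  intro k hk
  rcases Nat.lt_succ_iff_lt_or_eq.1 hk with hk | rfl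
  exacts [h k hk, hn]

lemma coeff_mul_of_agree_zero {n : ℕ} {f : PowerSeries R} (h : Agree n f 0) (g : PowerSeries R) :
    coeff n (f * g) = coeff n f * coeff 0 g := by
  rw [coeff_mul, Finset.sum_eq_single (n, 0)]
  · rintro ⟨i, j⟩ hp hne
    have := Finset.HasAntidiagonal.mem_antidiagonal.1 hp
    rw [h i (by grind)]; simp
  · intro h; simp at h

lemma coeff_mul_of_agree_zero' {n : ℕ} {f : PowerSeries R} (h : Agree n f 0)
    (g : PowerSeries R) : coeff n (g * f) = coeff 0 g * coeff n f := by
  rw [coeff_mul, Finset.sum_eq_single (0, n)]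
  · rintro ⟨i, j⟩ hp hne
    have := Finset.HasAntidiagonal.mem_antidiagonal.1 hp
    rw [h j (by grind)]; simp
  · intro h; simp at h

lemma coeff_succ_mul_of_agree_zero {n : ℕ} {f : PowerSeries R} (h : Agree n f 0)
    (g : PowerSeries R) :
    coeff (n + 1) (f * g) = coeff n f * coeff 1 g + coeff (n + 1) f * coeff 0 g := by
  rw [coeff_mul, Finset.sum_eq_add (n, 1) (n + 1, 0) (by simp)]
  · rintro ⟨i, j⟩ hp hne
    have := Finset.HasAntidiagonal.mem_antidiagonal.1 hp
    rw [h i (by grind)]; simp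
  · intro h; simp at h
  · intro h; simp at h

lemma coeff_succ_mul_of_agree_zero' {n : ℕ} {f : PowerSeries R} (h : Agree n f 0)
    (g : PowerSeries R) :
    coeff (n + 1) (g * f) = coeff 1 g * coeff n f + coeff 0 g * coeff (n + 1) f := by
  rw [coeff_mul, Finset.sum_eq_add (1, n) (0, n + 1) (by simp)]
  · rintro ⟨i, j⟩ hp hne
    have := Finset.HasAntidiagonal.mem_antidiagonal.1 hp
    rw [h j (by grind)]; simp
  · intro h; simp [add_comm] at h
  · intro h; simp at h

lemma coeff_zero_mul (f g : PowerSeries R) : coeff 0 (f * g) = coeff 0 f * coeff 0 g := by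
  simp [coeff_mul]

lemma coeff_one_mul' (f g : PowerSeries R) :
    coeff 1 (f * g) = coeff 0 f * coeff 1 g + coeff 1 f * coeff 0 g := by
  simpa using coeff_succ_mul_of_agree_zero (n := 0) (f := f) (fun k hk => by omega) g

/-- To first order past the degree up to which they agree, errors of factors add up. -/
lemma coeff_mul_sub_coeff_mul {n : ℕ} (hn : n ≠ 0) {f f' g g' : PowerSeries R}
    (h : Agree n f f') (h' : Agree n g g') (hf : coeff 0 f = 1) (hg : coeff 0 g = 1) :
    coeff n (f * g) - coeff n (f' * g') =
      (coeff n f - coeff n f') + (coeff n g - coeff n g') := by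
  have hf' : coeff 0 f' = 1 := by rw [← h 0 (by omega), hf]
  have e : f * g - f' * g' = (f - f') * g + f' * (g - g') := by noncomm_ring
  rw [← map_sub, e, map_add, coeff_mul_of_agree_zero (agree_iff_sub.1 h),
    coeff_mul_of_agree_zero' (agree_iff_sub.1 h'), hg, hf']
  simp

lemma coeff_zero_inv {g : (PowerSeries R)ˣ} (h : coeff 0 (g : PowerSeries R) = 1) :
    coeff 0 ((g⁻¹ : (PowerSeries R)ˣ) : PowerSeries R) = 1 := by
  have := congrArg (coeff 0) g.mul_inv
  rwa [coeff_zero_mul, h, one_mul, coeff_zero_one] at this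

lemma coeff_one_inv {g : (PowerSeries R)ˣ} (h : coeff 0 (g : PowerSeries R) = 1) :
    coeff 1 ((g⁻¹ : (PowerSeries R)ˣ) : PowerSeries R) = -coeff 1 (g : PowerSeries R) := by
  have := congrArg (coeff 1) g.mul_inv
  rw [coeff_one_mul', h, coeff_zero_inv h, one_mul, mul_one, coeff_one] at this
  exact eq_neg_of_add_eq_zero_left (by simpa using this)

lemma Agree.inv_mul {n : ℕ} {x g : (PowerSeries R)ˣ} (h : Agree n (x : PowerSeries R) g) :
    Agree n ((g⁻¹ * x : (PowerSeries R)ˣ) : PowerSeries R) 1 := by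
  have := (Agree.refl n ((g⁻¹ : (PowerSeries R)ˣ) : PowerSeries R)).mul h
  rwa [g.inv_mul, ← Units.val_mul] at this

lemma coeff_inv_mul {n : ℕ} (hn : n ≠ 0) {x g : (PowerSeries R)ˣ}
    (h : Agree n (x : PowerSeries R) g) (hg : coeff 0 (g : PowerSeries R) = 1) :
    coeff n ((g⁻¹ * x : (PowerSeries R)ˣ) : PowerSeries R) =
      coeff n (x : PowerSeries R) - coeff n (g : PowerSeries R) := by
  have hx : coeff 0 (x : PowerSeries R) = 1 := by rw [h 0 (by omega), hg]
  have := coeff_mul_sub_coeff_mul hn (Agree.refl n ((g⁻¹ : (PowerSeries R)ˣ) : PowerSeries R)) h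
    (coeff_zero_inv hg) hx
  rw [g.inv_mul, ← Units.val_mul] at this
  simpa [coeff_one, hn] using this

/-- Conjugation by `g` affects the leading term `a hⁿ` of `q - 1` only in degree `n + 1`, where it
adds the commutator of the linear coefficient of `g` with `a`. -/
lemma conj_leading {n : ℕ} {q g : (PowerSeries R)ˣ} (hq : Agree n (q : PowerSeries R) 1)
    (hg : coeff 0 (g : PowerSeries R) = 1) (hn : n ≠ 0) :
    Agree n ((g * q * g⁻¹ : (PowerSeries R)ˣ) : PowerSeries R) 1 ∧
    coeff n ((g * q * g⁻¹ : (PowerSeries R)ˣ) : PowerSeries R) = coeff n (q : PowerSeries R) ∧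
    coeff (n + 1) ((g * q * g⁻¹ : (PowerSeries R)ˣ) : PowerSeries R) =
      coeff (n + 1) (q : PowerSeries R) +
        ⁅coeff 1 (g : PowerSeries R), coeff n (q : PowerSeries R)⁆ := by
  set q' := g * q * g⁻¹ with hq'
  have h1 : Agree n (q' : PowerSeries R) 1 := by
    have := ((Agree.refl n (g : PowerSeries R)).mul hq).mul
      (Agree.refl n ((g⁻¹ : (PowerSeries R)ˣ) : PowerSeries R))
    rw [mul_one, g.mul_inv, ← Units.val_mul, ← Units.val_mul] at this
    exact this
  have e : ((q' : PowerSeries R) - 1) * g = g * ((q : PowerSeries R) - 1) := by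
    have : (q' : PowerSeries R) * g = g * q := by
      rw [← Units.val_mul, ← Units.val_mul]; simp [hq']
    rw [sub_mul, mul_sub, this, one_mul, mul_one]
  have h2 : coeff n (q' : PowerSeries R) = coeff n (q : PowerSeries R) := by
    have := congrArg (coeff n) e
    rw [coeff_mul_of_agree_zero (agree_iff_sub.1 h1),
      coeff_mul_of_agree_zero' (agree_iff_sub.1 hq), hg] at this
    simpa [coeff_one, hn] using this
  refine ⟨h1, h2, ?_⟩
  have := congrArg (coeff (n + 1)) e
  rw [coeff_succ_mul_of_agree_zero (agree_iff_sub.1 h1),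
    coeff_succ_mul_of_agree_zero' (agree_iff_sub.1 hq), hg] at this
  simp [coeff_one, hn, h2] at this
  rw [Ring.lie_def, ← add_sub_assoc, eq_sub_iff_add_eq, add_comm, this, add_comm]

/-- The operator `h · d/dh` on formal power series. -/
def euler (f : PowerSeries R) : PowerSeries R := PowerSeries.mk fun k => k • coeff k f

@[simp] lemma coeff_euler (k : ℕ) (f : PowerSeries R) : coeff k (euler f) = k • coeff k f := by
  simp [euler]

lemma euler_mul (f g : PowerSeries R) : euler (f * g) = euler f * g + f * euler g := by
  ext k
  rw [coeff_euler, map_add, coeff_mul, coeff_mul, coeff_mul, ← Finset.sum_add_distrib,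
    Finset.smul_sum]
  refine Finset.sum_congr rfl fun p hp => ?_
  rw [coeff_euler, coeff_euler, ← Finset.HasAntidiagonal.mem_antidiagonal.1 hp, add_smul,
    smul_mul_assoc, mul_smul_comm]

lemma euler_one : euler (1 : PowerSeries R) = 0 := by
  ext k
  rcases k with _ | k <;> simp [coeff_one]

lemma euler_C (b : R) : euler (C b) = 0 := by
  ext k
  rcases k with _ | k <;> simp [coeff_C]

-- A ring carries its commutator bracket without being registered as a `LieRing`, so the bilinearity
-- lemmas for Lie rings do not apply to it directly.
lemma commutator_zero (x : R) : ⁅x, (0 : R)⁆ = 0 := by simp [Ring.lie_def]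

lemma commutator_add (x y z : R) : ⁅x, y + z⁆ = ⁅x, y⁆ + ⁅x, z⁆ := by
  simp only [Ring.lie_def]; noncomm_ring

lemma add_commutator (x y z : R) : ⁅x + y, z⁆ = ⁅x, z⁆ + ⁅y, z⁆ := by
  simp only [Ring.lie_def]; noncomm_ring

variable [Algebra ℂ R]

lemma commutator_smul (c : ℂ) (x y : R) : ⁅x, c • y⁆ = c • ⁅x, y⁆ := by
  simp only [Ring.lie_def, mul_smul_comm, smul_mul_assoc, smul_sub]

lemma smul_commutator (c : ℂ) (x y : R) : ⁅c • x, y⁆ = c • ⁅x, y⁆ := by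
  simp only [Ring.lie_def, mul_smul_comm, smul_mul_assoc, smul_sub]

@[simp] lemma coeff_formalExp (k : ℕ) (x : R) :
    coeff k (formalExp x) = ((k ! : ℂ)⁻¹) • x ^ k := coeff_mk _ _

lemma formalExp_zero : formalExp (0 : R) = 1 := by
  ext k
  rcases k with _ | k <;> simp [coeff_one]

lemma formalExp_smul_mul (a b : ℂ) (x : R) :
    formalExp (a • x) * formalExp (b • x) = formalExp ((a + b) • x) := by
  ext n
  rw [coeff_mul, coeff_formalExp, smul_pow, smul_smul, add_pow, Finset.mul_sum, Finset.sum_smul,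
    Finset.Nat.sum_antidiagonal_eq_sum_range_succ_mk]
  refine Finset.sum_congr rfl fun i hi => ?_
  have hi : i ≤ n := by simpa [Nat.lt_succ_iff] using hi
  rw [coeff_formalExp, coeff_formalExp, smul_pow, smul_pow, smul_smul, smul_smul,
    smul_mul_smul_comm, ← pow_add, Nat.add_sub_cancel' hi, Nat.cast_choose ℂ hi]
  congr 1
  have := Nat.factorial_ne_zero n
  field_simp

lemma formalExp_mul_neg (x : R) : formalExp x * formalExp (-x) = 1 := by
  have := formalExp_smul_mul 1 (-1) x
  simpa [formalExp_zero] using this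

/-- `e^{h x}` as a unit of the ring of formal power series, with inverse `e^{-h x}`. -/
def expUnit (x : R) : (PowerSeries R)ˣ where
  val := formalExp x
  inv := formalExp (-x)
  val_inv := formalExp_mul_neg x
  inv_val := by simpa using formalExp_mul_neg (-x)

@[simp] lemma val_expUnit (x : R) : (expUnit x : PowerSeries R) = formalExp x := rfl

@[simp] lemma inv_expUnit (x : R) : (expUnit x)⁻¹ = expUnit (-x) := by
  ext1; rfl

lemma coeff_zero_formalExp (x : R) : coeff 0 (formalExp x) = 1 := by simp

lemma coeff_one_formalExp (x : R) : coeff 1 (formalExp x) = x := by simp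

lemma euler_formalExp (x : R) : euler (formalExp x) = X * (C x * formalExp x) := by
  ext k
  rcases k with _ | k
  · simp
  · rw [coeff_euler, coeff_succ_X_mul, coeff_C_mul, coeff_formalExp, coeff_formalExp,
      mul_smul_comm, ← pow_succ', ← Nat.cast_smul_eq_nsmul ℂ, smul_smul]
    congr 1
    rw [Nat.factorial_succ]
    have := Nat.factorial_ne_zero k
    have : (k : ℂ) + 1 ≠ 0 := by exact_mod_cast Nat.succ_ne_zero k
    push_cast
    field_simp

lemma C_mul_formalExp (x : R) : C x * formalExp x = formalExp x * C x := by
  ext k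
  rw [coeff_C_mul, coeff_mul_C, coeff_formalExp, mul_smul_comm, smul_mul_assoc, ← pow_succ,
    ← pow_succ']

/-- The differential equation satisfied by `e^{h x} b e^{-h x} = e^{h ad x} b`. -/
lemma succ_smul_coeff_conj (x b : R) (k : ℕ) :
    (k + 1) • coeff (k + 1) (formalExp x * C b * formalExp (-x)) =
      coeff k (formalExp x * C ⁅x, b⁆ * formalExp (-x)) := by
  have h : euler (formalExp x * C b * formalExp (-x)) =
      X * (formalExp x * C ⁅x, b⁆ * formalExp (-x)) := by
    have hc : (X : PowerSeries R) * formalExp x = formalExp x * X := X_mul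
    have hb : (X : PowerSeries R) * C b = C b * X := X_mul
    rw [euler_mul, euler_mul, euler_C, euler_formalExp, euler_formalExp, C_mul_formalExp x,
      Ring.lie_def, map_sub, map_mul, map_mul, map_neg, mul_zero, add_zero]
    have : formalExp x * C b * (X * (-C x * formalExp (-x))) =
        X * (formalExp x * C b * (-C x * formalExp (-x))) := by
      rw [← mul_assoc, ← X_mul, mul_assoc]
    rw [this]
    noncomm_ring
  have := congrArg (coeff (k + 1)) h
  rwa [coeff_euler, coeff_succ_X_mul] at this

end Exponentials

/-! ### Lie polynomials and group-like series -/

/-- The right-nested bracket `[x₁, [x₂, …, [xₙ₋₁, xₙ]]]` of the free generators named by a list. -/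
def nested : List (Fin 2) → Words
  | [] => 0
  | [i] => FreeAlgebra.ι ℂ i
  | i :: j :: l => ⁅(FreeAlgebra.ι ℂ i : Words), nested (j :: l)⁆

lemma nested_cons (i : Fin 2) {l : List (Fin 2)} (hl : l ≠ []) :
    nested (i :: l) = ⁅(FreeAlgebra.ι ℂ i : Words), nested l⁆ := by
  obtain ⟨j, l, rfl⟩ := List.exists_cons_of_ne_nil hl
  rfl

/-- The Lie polynomials of degree `n`, as the span of the right-nested brackets of length `n`. -/
def liePart (n : ℕ) : Submodule ℂ Words := Submodule.span ℂ (nested '' {l | l.length = n})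

lemma nested_mem_liePart (l : List (Fin 2)) : nested l ∈ liePart l.length :=
  Submodule.subset_span ⟨l, rfl, rfl⟩

lemma liePart_zero : liePart 0 = ⊥ := by
  rw [liePart, Submodule.span_eq_bot]
  rintro _ ⟨l, hl, rfl⟩
  rw [List.length_eq_zero_iff.1 hl]; rfl

lemma mem_liePart_one {x : Words} :
    x ∈ liePart 1 ↔ ∃ a b : ℂ, x = a • letterA + b • letterB := by
  have : nested '' {l | l.length = 1} = {letterA, letterB} := by
    ext y
    constructor
    · rintro ⟨l, hl, rfl⟩
      obtain ⟨i, rfl⟩ := List.length_eq_one_iff.1 hl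
      fin_cases i
      exacts [Or.inl rfl, Or.inr rfl]
    · rintro (rfl | rfl)
      exacts [⟨[0], rfl, rfl⟩, ⟨[1], rfl, rfl⟩]
  rw [liePart, this, Submodule.mem_span_pair]
  simp only [eq_comm]

lemma lie_mem_liePart {x b : Words} {m : ℕ} (hx : x ∈ liePart 1) (hb : b ∈ liePart m) :
    ⁅x, b⁆ ∈ liePart (m + 1) := by
  have key : ∀ i : Fin 2, ⁅(FreeAlgebra.ι ℂ i : Words), b⁆ ∈ liePart (m + 1) := by
    intro i
    induction hb using Submodule.span_induction with
    | mem y hy =>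
      obtain ⟨l, rfl, rfl⟩ := hy
      rcases eq_or_ne l [] with rfl | hl
      · rw [nested, commutator_zero]; exact zero_mem _
      · rw [← nested_cons i hl]
        exact nested_mem_liePart (i :: l)
    | zero => rw [commutator_zero]; exact zero_mem _
    | add y z _ _ hy hz => rw [commutator_add]; exact add_mem hy hz
    | smul c y _ hy => rw [commutator_smul]; exact Submodule.smul_mem _ _ hy
  obtain ⟨a, c, rfl⟩ := mem_liePart_one.1 hx
  rw [add_commutator, smul_commutator, smul_commutator]
  exact add_mem (Submodule.smul_mem _ _ (key 0)) (Submodule.smul_mem _ _ (key 1))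

/-- Power series whose coefficient of `hᵏ` is a Lie polynomial of degree `k + d`. -/
def IsLieSeries (d : ℕ) (y : PowerSeries Words) : Prop := ∀ k, coeff k y ∈ liePart (k + d)

lemma IsLieSeries.add {d : ℕ} {y z : PowerSeries Words} (hy : IsLieSeries d y)
    (hz : IsLieSeries d z) : IsLieSeries d (y + z) := fun k => by
  rw [map_add]; exact add_mem (hy k) (hz k)

lemma IsLieSeries.neg {d : ℕ} {y : PowerSeries Words} (hy : IsLieSeries d y) :
    IsLieSeries d (-y) := fun k => by
  rw [map_neg]; exact neg_mem (hy k)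

lemma coeff_conj_C_mem {x b : Words} {m : ℕ} (hx : x ∈ liePart 1) (hb : b ∈ liePart m) (k : ℕ) :
    coeff k (formalExp x * C b * formalExp (-x)) ∈ liePart (k + m) := by
  induction k generalizing b m with
  | zero => simpa [coeff_zero_mul] using hb
  | succ k ih =>
    have h := ih (lie_mem_liePart hx hb)
    rw [← succ_smul_coeff_conj, ← Nat.cast_smul_eq_nsmul ℂ,
      Submodule.smul_mem_iff _ (by exact_mod_cast k.succ_ne_zero)] at h
    convert h using 2
    ring

/-- By induction on the degree of the coefficient: splitting off the constant coefficient of `y` leaves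
`h` times a Lie series whose grading is shifted by one more. -/
lemma IsLieSeries.conj {x : Words} {d : ℕ} {y : PowerSeries Words} (hx : x ∈ liePart 1)
    (hy : IsLieSeries d y) : IsLieSeries d (formalExp x * y * formalExp (-x)) := by
  intro k
  induction k generalizing d y with
  | zero => simpa [coeff_zero_mul] using hy 0
  | succ k ih =>
    set z : PowerSeries Words := PowerSeries.mk fun p => coeff (p + 1) y with hz
    have hzL : IsLieSeries (d + 1) z := fun p => by
      have := hy (p + 1)
      rw [hz, coeff_mk]
      convert this using 2
      ring
    have e : formalExp x * y * formalExp (-x) =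
        X * (formalExp x * z * formalExp (-x)) +
          formalExp x * C (coeff 0 y) * formalExp (-x) := by
      conv_lhs => rw [eq_X_mul_shift_add_const y]
      rw [mul_add, add_mul, ← mul_assoc (formalExp x),
        show formalExp x * X = X * formalExp x from X_mul.symm,
        mul_assoc X, mul_assoc X]
      simp [hz]
    rw [e, map_add, coeff_succ_X_mul]
    refine add_mem ?_ ?_
    · convert ih hzL using 2
      ring
    · convert coeff_conj_C_mem hx (hy 0) (k + 1) using 2
      ring

/-- A group of formal power series playing the role of the group-like elements: series `g` with
constant term `1` that preserve Lie series under conjugation and whose logarithmic derivative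
`g⁻¹ · h dg/dh` is a Lie series. -/
def lieGroup : Subgroup (PowerSeries Words)ˣ where
  carrier := {g | coeff 0 (g : PowerSeries Words) = 1 ∧
    (∀ y, IsLieSeries 0 y → IsLieSeries 0 (g * y * (g⁻¹ : (PowerSeries Words)ˣ))) ∧
    (∀ y, IsLieSeries 0 y → IsLieSeries 0 ((g⁻¹ : (PowerSeries Words)ˣ) * y * g)) ∧
    IsLieSeries 0 ((g⁻¹ : (PowerSeries Words)ˣ) * euler (g : PowerSeries Words))}
  one_mem' := by
    refine ⟨by simp, fun y hy => by simpa using hy, fun y hy => by simpa using hy, fun k => ?_⟩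
    rw [Units.val_one, euler_one, mul_zero, map_zero]
    exact zero_mem _
  mul_mem' := by
    rintro g k ⟨hg0, hg1, hg2, hg3⟩ ⟨hk0, hk1, hk2, hk3⟩
    refine ⟨?_, fun y hy => ?_, fun y hy => ?_, ?_⟩
    · rw [Units.val_mul, coeff_zero_mul, hg0, hk0, one_mul]
    · simpa [mul_assoc] using hg1 _ (hk1 _ hy)
    · simpa [mul_assoc] using hk2 _ (hg2 _ hy)
    · have := (hk2 _ hg3).add hk3
      simpa [euler_mul, mul_add, mul_assoc] using this
  inv_mem' := by
    rintro g ⟨hg0, hg1, hg2, hg3⟩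
    refine ⟨coeff_zero_inv hg0, by simpa using hg2, by simpa using hg1, ?_⟩
    have h := congrArg euler g.mul_inv
    rw [euler_mul, euler_one] at h
    have := (hg1 _ hg3).neg
    rw [inv_inv, eq_neg_of_add_eq_zero_right h]
    simpa [mul_assoc] using this

lemma coeff_zero_of_mem {g : (PowerSeries Words)ˣ} (hg : g ∈ lieGroup) :
    coeff 0 (g : PowerSeries Words) = 1 := hg.1

lemma expUnit_mem_lieGroup {x : Words} (hx : x ∈ liePart 1) : expUnit x ∈ lieGroup := by
  refine ⟨coeff_zero_formalExp x, fun y hy => ?_, fun y hy => ?_, fun k => ?_⟩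
  · rw [inv_expUnit]
    exact hy.conj hx
  · rw [inv_expUnit]
    simpa using hy.conj (neg_mem hx)
  · rw [val_expUnit, euler_formalExp, C_mul_formalExp, ← mul_assoc, ← X_mul, mul_assoc,
      ← mul_assoc ((expUnit x)⁻¹ : (PowerSeries Words)ˣ).val, ← val_expUnit, Units.inv_mul, one_mul]
    rcases k with _ | _ | k
    · simp
    · rw [coeff_succ_X_mul]; simpa using hx
    · rw [coeff_succ_X_mul]; simp

/-- With `y` the Lie series `q⁻¹ · h dq/dh`, comparing coefficients in `h dq/dh = q y` gives
`k qₖ = yₖ` as soon as all mixed terms `qᵢ yⱼ` with `i, j ≠ 0` and `i + j = k` vanish. -/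
lemma coeff_mem_liePart_aux {q : (PowerSeries Words)ˣ} (hq : q ∈ lieGroup) {k : ℕ} (hk : k ≠ 0)
    (h : ∀ i j, i + j = k → i ≠ 0 → j ≠ 0 → coeff i (q : PowerSeries Words) = 0 ∨
      coeff j (((q⁻¹ : (PowerSeries Words)ˣ) : PowerSeries Words) * euler (q : PowerSeries Words))
        = 0) : coeff k (q : PowerSeries Words) ∈ liePart k := by
  set y := ((q⁻¹ : (PowerSeries Words)ˣ) : PowerSeries Words) * euler (q : PowerSeries Words)
    with hy
  have hyL : IsLieSeries 0 y := hq.2.2.2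
  have hy0 : coeff 0 y = 0 := by simpa [liePart_zero] using hyL 0
  have e : euler (q : PowerSeries Words) = q * y := by rw [hy, ← mul_assoc, q.mul_inv, one_mul]
  have e' := congrArg (coeff k) e
  rw [coeff_euler, coeff_mul, Finset.sum_eq_single (0, k), coeff_zero_of_mem hq, one_mul] at e'
  · have := hyL k
    rw [← e', ← Nat.cast_smul_eq_nsmul ℂ,
      Submodule.smul_mem_iff _ (by exact_mod_cast hk)] at this
    exact this
  · rintro ⟨i, j⟩ hp hne
    have hp := Finset.HasAntidiagonal.mem_antidiagonal.1 hp
    rcases eq_or_ne j 0 with rfl | hj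
    · simp [hy0]
    rcases h i j hp (by grind) hj with h | h <;> simp [h]
  · intro h; simp at h

lemma coeff_mem_liePart {n : ℕ} (hn : n ≠ 0) {q : (PowerSeries Words)ˣ} (hq : q ∈ lieGroup)
    (h : Agree n (q : PowerSeries Words) 1) : coeff n (q : PowerSeries Words) ∈ liePart n := by
  refine coeff_mem_liePart_aux hq hn fun i j hij hi hj => Or.inl ?_
  rw [h i (by omega), coeff_one, if_neg hi]

/-- If `q - 1` starts in degree `n ≥ 2`, the coefficient after the leading one is still free of
products of lower coefficients, hence a Lie polynomial. -/
lemma coeff_succ_mem_liePart {n : ℕ} (hn : 2 ≤ n) {q : (PowerSeries Words)ˣ} (hq : q ∈ lieGroup)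
    (h : Agree n (q : PowerSeries Words) 1) :
    coeff (n + 1) (q : PowerSeries Words) ∈ liePart (n + 1) := by
  refine coeff_mem_liePart_aux hq (by omega) fun i j hij hi hj => ?_
  rcases lt_or_ge i n with h' | h'
  · left
    rw [h i h', coeff_one, if_neg hi]
  · right
    obtain rfl : j = 1 := by omega
    rw [coeff_one_mul', coeff_euler, coeff_euler, h 1 (by omega)]
    simp [coeff_one]

lemma coeff_sub_mem_liePart {n : ℕ} (hn : n ≠ 0) {x g : (PowerSeries Words)ˣ}
    (hx : x ∈ lieGroup) (hg : g ∈ lieGroup) (h : Agree n (x : PowerSeries Words) g) :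
    coeff n (x : PowerSeries Words) - coeff n (g : PowerSeries Words) ∈ liePart n := by
  rw [← coeff_inv_mul hn h (coeff_zero_of_mem hg)]
  exact coeff_mem_liePart hn (mul_mem (inv_mem hg) hx) h.inv_mul

/-- Every nested bracket of length `n` occurs as leading coefficient: take iterated commutators of
exponentials of the generators. -/
lemma exists_leading_nested (c : ℂ) {l : List (Fin 2)} (hl : l ≠ []) :
    ∃ k ∈ lieGroup, Agree l.length (k : PowerSeries Words) 1 ∧
      coeff l.length (k : PowerSeries Words) = c • nested l := by
  have hι (i : Fin 2) : (FreeAlgebra.ι ℂ i : Words) ∈ liePart 1 := nested_mem_liePart [i]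
  induction l with
  | nil => exact absurd rfl hl
  | cons i l ih =>
    rcases eq_or_ne l [] with rfl | hl'
    · refine ⟨expUnit (c • FreeAlgebra.ι ℂ i),
        expUnit_mem_lieGroup (Submodule.smul_mem _ _ (hι i)), ?_, by simp [nested]⟩
      intro k hk
      obtain rfl : k = 0 := by simpa using hk
      simp
    · obtain ⟨k, hk, hk1, hkn⟩ := ih hl'
      have hn : l.length ≠ 0 := by simpa using hl'
      set e : (PowerSeries Words)ˣ := expUnit (FreeAlgebra.ι ℂ i)
      have he : e ∈ lieGroup := expUnit_mem_lieGroup (hι i)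
      obtain ⟨h1, h2, h3⟩ := conj_leading hk1 (coeff_zero_of_mem he) hn
      have h4 : Agree (l.length + 1) ((e * k * e⁻¹ : (PowerSeries Words)ˣ) : PowerSeries Words) k :=
        (h1.trans hk1.symm).succ h2
      refine ⟨k⁻¹ * (e * k * e⁻¹),
        mul_mem (inv_mem hk) (mul_mem (mul_mem he hk) (inv_mem he)), h4.inv_mul, ?_⟩
      rw [List.length_cons, coeff_inv_mul (by omega) h4 (coeff_zero_of_mem hk), h3, hkn,
        nested_cons i hl', add_sub_cancel_left, commutator_smul]
      congr 2
      exact coeff_one_formalExp _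

/-! ### Compositions of admissible flows -/

/-- The compositions of flows `e^{h a A}` with real `a ≥ 0` and `e^{h b B}` with complex `b`. -/
def methods : Submonoid (PowerSeries Words)ˣ :=
  Submonoid.closure ({x | ∃ a : ℝ, 0 ≤ a ∧ x = expUnit ((a : ℂ) • letterA)} ∪
    {x | ∃ b : ℂ, x = expUnit (b • letterB)})

lemma expA_mem_methods {a : ℝ} (ha : 0 ≤ a) : expUnit ((a : ℂ) • letterA) ∈ methods :=
  Submonoid.subset_closure (Or.inl ⟨a, ha, rfl⟩)

lemma expB_mem_methods (b : ℂ) : expUnit (b • letterB) ∈ methods :=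
  Submonoid.subset_closure (Or.inr ⟨b, rfl⟩)

lemma letterA_mem_liePart : letterA ∈ liePart 1 := nested_mem_liePart [0]

lemma letterB_mem_liePart : letterB ∈ liePart 1 := nested_mem_liePart [1]

lemma expA_mem_lieGroup (a : ℂ) : expUnit (a • letterA) ∈ lieGroup :=
  expUnit_mem_lieGroup (Submodule.smul_mem _ _ letterA_mem_liePart)

lemma expB_mem_lieGroup (b : ℂ) : expUnit (b • letterB) ∈ lieGroup :=
  expUnit_mem_lieGroup (Submodule.smul_mem _ _ letterB_mem_liePart)

lemma methods_le_lieGroup {x : (PowerSeries Words)ˣ} (hx : x ∈ methods) : x ∈ lieGroup := by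
  have : methods ≤ lieGroup.toSubmonoid := by
    refine Submonoid.closure_le.2 ?_
    rintro _ (⟨a, _, rfl⟩ | ⟨b, rfl⟩)
    exacts [expA_mem_lieGroup _, expB_mem_lieGroup _]
  exact this hx

lemma method_cons {s : ℕ} (a₀ b₀ : ℂ) (a : Fin s → ℂ) (b : Fin (s + 1) → ℂ) :
    method (Fin.cons a₀ a : Fin (s + 1) → ℂ) (Fin.cons b₀ b : Fin (s + 2) → ℂ) letterA letterB =
      formalExp (b₀ • letterB) * formalExp (a₀ • letterA) * method a b letterA letterB := by
  simp only [method, List.ofFn_succ, List.prod_cons, Fin.cons_zero, Fin.cons_succ, mul_assoc]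

lemma exists_method_eq {x : (PowerSeries Words)ˣ} (hx : x ∈ methods) :
    ∃ (s : ℕ) (a : Fin s → ℂ) (b : Fin (s + 1) → ℂ),
      (∀ i, 0 ≤ (a i).re) ∧ method a b letterA letterB = x := by
  induction hx using Submonoid.closure_induction_left with
  | one => exact ⟨0, Fin.elim0, fun _ => 0, fun i => i.elim0, by simp [method, formalExp_zero]⟩
  | mul_left y hy x _ ih =>
    obtain ⟨s, a, b, ha, hab⟩ := ih
    rcases hy with ⟨a₀, ha₀, rfl⟩ | ⟨b₀, rfl⟩
    · refine ⟨s + 1, Fin.cons (a₀ : ℂ) a, Fin.cons 0 b, fun i => ?_, ?_⟩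
      · refine Fin.cases ?_ (fun i => ?_) i
        · simpa using ha₀
        · simpa using ha i
      · rw [method_cons, hab, zero_smul, formalExp_zero, one_mul, Units.val_mul, val_expUnit]
    · refine ⟨s, a, Function.update b 0 (b₀ + b 0), ha, ?_⟩
      rw [Units.val_mul, ← hab, val_expUnit, method, method, ← mul_assoc, formalExp_smul_mul]
      simp

/-! ### Rotations of the second generator -/

/-- The automorphism of the free algebra given by `A ↦ A`, `B ↦ ωB`. -/
def rotate (ω : ℂ) : Words →ₐ[ℂ] Words :=
  FreeAlgebra.lift ℂ ![letterA, ω • letterB]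

lemma rotate_letterA (ω : ℂ) : rotate ω letterA = letterA := by simp [rotate, letterA]

lemma rotate_letterB (ω : ℂ) : rotate ω letterB = ω • letterB := by simp [rotate, letterB]

lemma rotate_nested (ω : ℂ) (l : List (Fin 2)) :
    rotate ω (nested l) = ω ^ l.count 1 • nested l := by
  have hι (i : Fin 2) : rotate ω (FreeAlgebra.ι ℂ i) = ω ^ [i].count 1 • FreeAlgebra.ι ℂ i := by
    fin_cases i <;> simp [rotate, letterA, letterB]
  induction l with
  | nil => simp [nested]
  | cons i l ih =>
    rcases eq_or_ne l [] with rfl | hl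
    · exact hι i
    · rw [nested_cons i hl, Ring.lie_def, map_sub, map_mul, map_mul, ih, hι,
        show i :: l = [i] ++ l from rfl, List.count_append, pow_add, smul_mul_smul_comm,
        smul_mul_smul_comm, mul_comm (ω ^ l.count 1), smul_sub]

lemma nested_eq_zero {l : List (Fin 2)} (hl : 2 ≤ l.length) (h : l.count 1 = 0) :
    nested l = 0 := by
  induction l with
  | nil => rfl
  | cons i l ih =>
    rcases l with _ | ⟨j, l⟩
    · simp at hl
    · have hi : i = 0 := by
        rcases Fin.exists_fin_two.1 ⟨i, rfl⟩ with h' | h'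
        · exact h'
        · subst h'; simp at h
      rw [nested_cons i (by simp)]
      rcases l with _ | ⟨k, l⟩
      · have hj : j = 0 := by
          rcases Fin.exists_fin_two.1 ⟨j, rfl⟩ with h' | h'
          · exact h'
          · subst h'; simp [List.count_cons] at h
        simp [hi, hj, nested, Ring.lie_def]
      · rw [ih (by simp) (by simp [List.count_cons] at h ⊢; omega), commutator_zero]

/-- Averaging over the rotations of `B` by `N`-th roots of unity kills all Lie polynomials of
degree between `2` and `N - 1`, as each of their words contains some `B`, but fewer than `N`. -/
lemma sum_rotate_eq_zero {N n : ℕ} {ζ : ℂ} (hζ : IsPrimitiveRoot ζ N) (hn : 2 ≤ n) (hN : n < N)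
    {w : Words} (hw : w ∈ liePart n) : ∑ m ∈ Finset.range N, rotate (ζ ^ m) w = 0 := by
  induction hw using Submodule.span_induction with
  | mem y hy =>
    obtain ⟨l, rfl, rfl⟩ := hy
    rcases Nat.eq_zero_or_pos (l.count 1) with h | h
    · simp [nested_eq_zero hn h]
    · have hlt : l.count 1 < N := List.count_le_length.trans_lt hN
      have h1 : ζ ^ l.count 1 ≠ 1 := hζ.pow_ne_one_of_pos_of_lt h.ne' hlt
      simp_rw [rotate_nested, ← Finset.sum_smul, ← pow_mul, mul_comm _ (l.count 1), pow_mul]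
      rw [geom_sum_eq h1, ← pow_mul, mul_comm, pow_mul, hζ.pow_eq_one]
      simp
  | zero => simp
  | add y z _ _ hy hz => simp [Finset.sum_add_distrib, hy, hz]
  | smul c y _ hy => simp [← Finset.smul_sum, hy]

/-- `rotate` acting on the coefficients of invertible power series. -/
def rotateUnit (ω : ℂ) : (PowerSeries Words)ˣ →* (PowerSeries Words)ˣ :=
  Units.map (PowerSeries.map (rotate ω : Words →+* Words) : PowerSeries Words →* PowerSeries Words)

@[simp] lemma coeff_rotateUnit (ω : ℂ) (x : (PowerSeries Words)ˣ) (k : ℕ) :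
    coeff k (rotateUnit ω x : PowerSeries Words) = rotate ω (coeff k (x : PowerSeries Words)) := by
  simp [rotateUnit]

lemma rotateUnit_exp (ω : ℂ) (x : Words) : rotateUnit ω (expUnit x) = expUnit (rotate ω x) := by
  ext k
  simp

lemma rotateUnit_expA (ω a : ℂ) :
    rotateUnit ω (expUnit (a • letterA)) = expUnit (a • letterA) := by
  rw [rotateUnit_exp, map_smul, rotate_letterA]

lemma rotateUnit_mem_methods (ω : ℂ) {x : (PowerSeries Words)ˣ} (hx : x ∈ methods) :
    rotateUnit ω x ∈ methods := by
  have : methods ≤ methods.comap (rotateUnit ω) := by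
    refine Submonoid.closure_le.2 ?_
    rintro _ (⟨a, ha, rfl⟩ | ⟨b, rfl⟩)
    · change rotateUnit ω _ ∈ methods
      rw [rotateUnit_expA]
      exact expA_mem_methods ha
    · simpa [rotateUnit_exp, rotate_letterB, smul_smul] using expB_mem_methods (b * ω)
  exact this hx

/-! ### Reachability and flexibility -/

/-- Every element of the group with positive real `A`-component in degree `1` can be matched up to
degree `n` by a composition of admissible flows. -/
def Reachable (n : ℕ) : Prop :=
  ∀ g ∈ lieGroup, ∀ (t : ℝ) (β : ℂ), 0 < t →
    coeff 1 (g : PowerSeries Words) = (t : ℂ) • letterA + β • letterB →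
    ∃ x ∈ methods, Agree (n + 1) (x : PowerSeries Words) g

/-- Around group elements `G` of arbitrarily small duration, all errors from `V` in the
coefficient of `hⁿ⁺¹` are realised by admissible compositions matching `G` up to degree `n`. -/
def Flexible (n : ℕ) (V : Submodule ℂ Words) : Prop :=
  ∀ ε : ℝ, 0 < ε → ∃ G ∈ lieGroup, ∃ t : ℝ, 0 ≤ t ∧ t < ε ∧
    coeff 1 (G : PowerSeries Words) = (t : ℂ) • letterA ∧
    ∀ z ∈ V, ∃ x ∈ methods, Agree (n + 1) (x : PowerSeries Words) G ∧
      coeff (n + 1) (x : PowerSeries Words) - coeff (n + 1) (G : PowerSeries Words) = z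

lemma Flexible.mono {n : ℕ} {V W : Submodule ℂ Words} (h : Flexible n W) (hV : V ≤ W) :
    Flexible n V := by
  intro ε hε
  obtain ⟨G, hG, t, h0, h1, h2, h3⟩ := h ε hε
  exact ⟨G, hG, t, h0, h1, h2, fun z hz => h3 z (hV hz)⟩

lemma flexible_bot (n : ℕ) : Flexible n ⊥ := by
  intro ε hε
  refine ⟨1, one_mem _, 0, le_rfl, hε, by simp [coeff_one], fun z hz => ?_⟩
  rw [Submodule.mem_bot] at hz
  exact ⟨1, one_mem _, Agree.refl _ _, by simp [hz]⟩

lemma Flexible.sup {n : ℕ} {V W : Submodule ℂ Words} (hV : Flexible n V) (hW : Flexible n W) :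
    Flexible n (V ⊔ W) := by
  intro ε hε
  obtain ⟨G, hG, t, h0, h1, h2, h3⟩ := hV (ε / 2) (by positivity)
  obtain ⟨G', hG', t', h0', h1', h2', h3'⟩ := hW (ε / 2) (by positivity)
  refine ⟨G * G', mul_mem hG hG', t + t', by positivity, by linarith, ?_, fun z hz => ?_⟩
  · rw [Units.val_mul, coeff_one_mul', coeff_zero_of_mem hG, coeff_zero_of_mem hG', h2, h2']
    simp [add_smul, add_comm]
  · obtain ⟨v, hv, w, hw, rfl⟩ := Submodule.mem_sup.1 hz
    obtain ⟨x, hx, hxG, hxv⟩ := h3 v hv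
    obtain ⟨x', hx', hxG', hxw⟩ := h3' w hw
    refine ⟨x * x', mul_mem hx hx', hxG.mul hxG', ?_⟩
    rw [Units.val_mul, Units.val_mul, coeff_mul_sub_coeff_mul (by omega) hxG hxG'
      (coeff_zero_of_mem (methods_le_lieGroup hx))
      (coeff_zero_of_mem (methods_le_lieGroup hx')), hxv, hxw]

lemma flexible_liePart {n m : ℕ}
    (h : ∀ l : List (Fin 2), l.length = m → Flexible n (Submodule.span ℂ {nested l})) :
    Flexible n (liePart m) := by
  have hfin : {l : List (Fin 2) | l.length = m}.Finite := List.finite_length_eq _ _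
  have key : ∀ s : Set (List (Fin 2)), s.Finite → s ⊆ {l | l.length = m} →
      Flexible n (Submodule.span ℂ (nested '' s)) := by
    intro s hs
    induction s, hs using Set.Finite.induction_on with
    | empty => intro _; simpa using flexible_bot n
    | insert _ _ ih =>
      intro hsub
      rw [Set.image_insert_eq, Submodule.span_insert]
      exact (h _ (hsub (Set.mem_insert _ _))).sup (ih fun l hl => hsub (Set.mem_insert_of_mem _ hl))
  exact key _ hfin subset_rfl

lemma reachable_one : Reachable 1 := by
  intro g hg t β ht h1
  refine ⟨expUnit ((t : ℂ) • letterA) * expUnit (β • letterB),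
    mul_mem (expA_mem_methods ht.le) (expB_mem_methods β), ?_⟩
  refine Agree.succ (fun k hk => ?_) ?_
  · obtain rfl : k = 0 := by omega
    rw [coeff_zero_of_mem hg]
    simp [coeff_zero_mul]
  · rw [h1, Units.val_mul, coeff_one_mul']
    simp [add_comm]

/-- Write `g = (g G⁻¹) G`, match `g G⁻¹` up to degree `n`, and let the match of `G` compensate the error
made in degree `n + 1`. -/
lemma Reachable.succ {n : ℕ} (h : Reachable n) (hF : Flexible n (liePart (n + 1))) :
    Reachable (n + 1) := by
  intro g hg t β ht h1
  obtain ⟨G, hG, s, hs0, hst, hs1, hGz⟩ := hF t ht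
  have hg' : g * G⁻¹ ∈ lieGroup := mul_mem hg (inv_mem hG)
  obtain ⟨x', hx', hxg⟩ := h (g * G⁻¹) hg' (t - s) β (by linarith) (by
    rw [Units.val_mul, coeff_one_mul', coeff_zero_of_mem hg, coeff_zero_of_mem (inv_mem hG),
      coeff_one_inv (coeff_zero_of_mem hG), h1, hs1]
    simp only [Complex.ofReal_sub, sub_smul, one_mul, mul_one]
    abel)
  obtain ⟨x, hx, hxG, hxz⟩ := hGz _ (neg_mem (coeff_sub_mem_liePart n.succ_ne_zero
    (methods_le_lieGroup hx') hg' hxg))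
  refine ⟨x' * x, mul_mem hx' hx, ?_⟩
  have e : ((g * G⁻¹ : (PowerSeries Words)ˣ) : PowerSeries Words) * G = g := by
    rw [← Units.val_mul, inv_mul_cancel_right]
  have h2 := hxg.mul hxG
  have h3 := coeff_mul_sub_coeff_mul n.succ_ne_zero hxg hxG
      (coeff_zero_of_mem (methods_le_lieGroup hx')) (coeff_zero_of_mem (methods_le_lieGroup hx))
  rw [e] at h2 h3
  rw [Units.val_mul]
  refine h2.succ ?_
  rw [hxz, add_neg_cancel] at h3
  exact sub_eq_zero.1 h3

lemma expB_conj_mem_methods (u : ℂ) {x : (PowerSeries Words)ˣ} (hx : x ∈ methods) :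
    expUnit (u • letterB) * x * (expUnit (u • letterB))⁻¹ ∈ methods := by
  rw [inv_expUnit, ← neg_smul]
  exact mul_mem (mul_mem (expB_mem_methods u) hx) (expB_mem_methods _)

/-- The error in `h²` is spanned by `[B, A]`, which conjugating `e^{h d A}` by `e^{h u B}` produces with
an arbitrary complex factor `u d`. -/
lemma flexible_one : Flexible 1 (liePart 2) := by
  have hz : nested [1, 0] = ⁅letterB, letterA⁆ := rfl
  have key : Flexible 1 (Submodule.span ℂ {nested [1, 0]}) := by
    intro ε hε
    have hG := expA_mem_lieGroup ((ε / 2 : ℝ) : ℂ)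
    refine ⟨_, hG, ε / 2, by positivity, by linarith, coeff_one_formalExp _, fun z hz' => ?_⟩
    obtain ⟨c, rfl⟩ := Submodule.mem_span_singleton.1 hz'
    have hε2 : ((ε / 2 : ℝ) : ℂ) ≠ 0 := by exact_mod_cast (by positivity : ε / 2 ≠ 0)
    set G : (PowerSeries Words)ˣ := expUnit (((ε / 2 : ℝ) : ℂ) • letterA) with hGdef
    have hGe : Agree 1 (G : PowerSeries Words) 1 := by
      intro k hk
      obtain rfl : k = 0 := by omega
      rw [coeff_zero_of_mem hG]; simp
    set u : ℂ := c / ((ε / 2 : ℝ) : ℂ) with hu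
    obtain ⟨h1, h2, h3⟩ := conj_leading (g := expUnit (u • letterB)) hGe
      (coeff_zero_formalExp _) one_ne_zero
    refine ⟨_, expB_conj_mem_methods u (expA_mem_methods (a := ε / 2) (by positivity)),
      (h1.trans hGe.symm).succ h2, ?_⟩
    rw [h3, add_sub_cancel_left, hGdef, val_expUnit, val_expUnit, coeff_one_formalExp,
      coeff_one_formalExp, smul_commutator, commutator_smul, smul_smul, hu, div_mul_cancel₀ _ hε2,
      hz]
  refine flexible_liePart fun l hl => key.mono ?_
  rw [Submodule.span_singleton_le_iff_mem, Submodule.mem_span_singleton]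
  obtain ⟨i, j, rfl⟩ := List.length_eq_two.1 hl
  fin_cases i <;> fin_cases j
  · exact ⟨0, by simp [nested, Ring.lie_def]⟩
  · exact ⟨-1, by simp [nested, Ring.lie_def]⟩
  · exact ⟨1, by simp⟩
  · exact ⟨0, by simp [nested, Ring.lie_def]⟩

/-! ### Averaging over rotations -/

section Products

variable {R : Type*} [Ring R]

lemma coeff_prod_of_const {g : ℕ → (PowerSeries R)ˣ} {a : R}
    (hg0 : ∀ m, coeff 0 (g m : PowerSeries R) = 1) (hg1 : ∀ m, coeff 1 (g m : PowerSeries R) = a)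
    (L : ℕ) :
    coeff 0 ((((List.range L).map g).prod : (PowerSeries R)ˣ) : PowerSeries R) = 1 ∧
      coeff 1 ((((List.range L).map g).prod : (PowerSeries R)ˣ) : PowerSeries R) = L • a := by
  induction L with
  | zero => simp [coeff_one]
  | succ L ih =>
    rw [List.prod_range_succ, Units.val_mul, coeff_zero_mul, coeff_one_mul', ih.1, ih.2, hg0, hg1]
    simp [add_mul, add_comm]

lemma mul_leading {n : ℕ} (hn : 2 ≤ n) {f g : PowerSeries R} (hf : Agree n f 1)
    (hg : Agree n g 1) :
    Agree n (f * g) 1 ∧ coeff n (f * g) = coeff n f + coeff n g ∧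
      coeff (n + 1) (f * g) = coeff (n + 1) f + coeff (n + 1) g := by
  have e : f * g = f + g - 1 + (f - 1) * (g - 1) := by noncomm_ring
  have hg' := agree_iff_sub.1 hg
  have h1 : coeff 1 (g - 1) = 0 := by simpa using hg' 1 (by omega)
  have h0 : coeff 0 (g - 1) = 0 := by simpa using hg' 0 (by omega)
  refine ⟨by simpa using hf.mul hg, ?_, ?_⟩
  · rw [e, map_add, coeff_mul_of_agree_zero (agree_iff_sub.1 hf), h0]
    simp [coeff_one, show n ≠ 0 by omega]
  · rw [e, map_add, coeff_succ_mul_of_agree_zero (agree_iff_sub.1 hf), h0, h1]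
    simp [coeff_one]

/-- Replacing each factor `gₘ` of a product by `gₘ rₘ`, where `rₘ - 1` starts in degree `n`,
multiplies the product by a series whose first two coefficients are the sums of those of the `rₘ`,
up to the commutators that arise from moving each `rₘ` past the later `gᵢ`. -/
lemma prod_leading {n : ℕ} (hn : 2 ≤ n) {g r : ℕ → (PowerSeries R)ˣ} {a : R}
    (hg0 : ∀ m, coeff 0 (g m : PowerSeries R) = 1) (hg1 : ∀ m, coeff 1 (g m : PowerSeries R) = a)
    (hr : ∀ m, Agree n (r m : PowerSeries R) 1) (L : ℕ) :
    ∃ Q : (PowerSeries R)ˣ,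
      ((List.range L).map fun m => g m * r m).prod = ((List.range L).map g).prod * Q ∧
      Agree n (Q : PowerSeries R) 1 ∧
      coeff n (Q : PowerSeries R) = ∑ m ∈ Finset.range L, coeff n (r m : PowerSeries R) ∧
      coeff (n + 1) (Q : PowerSeries R) =
        ∑ m ∈ Finset.range L, (coeff (n + 1) (r m : PowerSeries R) -
          ⁅a, ∑ i ∈ Finset.range m, coeff n (r i : PowerSeries R)⁆) := by
  induction L with
  | zero => exact ⟨1, by simp, Agree.refl _ _, by simp [coeff_one, show n ≠ 0 by omega],
      by simp [coeff_one]⟩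
  | succ L ih =>
    obtain ⟨Q, h0, h1, h2, h3⟩ := ih
    obtain ⟨c1, c2, c3⟩ := conj_leading h1 (coeff_zero_inv (hg0 L)) (by omega)
    rw [inv_inv] at c1 c2 c3
    obtain ⟨m1, m2, m3⟩ := mul_leading hn c1 (hr L)
    refine ⟨(g L)⁻¹ * Q * g L * r L, ?_, m1, ?_, ?_⟩
    · rw [List.prod_range_succ, List.prod_range_succ, h0]
      group
    · rw [Units.val_mul, m2, c2, h2, Finset.sum_range_succ]
    · rw [Units.val_mul, m3, c3, h3, h2, Finset.sum_range_succ, coeff_one_inv (hg0 L), hg1,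
        show ∀ y : R, ⁅-a, y⁆ = -⁅a, y⁆ from fun y => by simp [Ring.lie_def]; abel]
      abel

end Products

lemma one_sub_mul_sum_geom_sum {ξ : ℂ} {N : ℕ} (h1 : ξ ≠ 1) (hN : ξ ^ N = 1) :
    (1 - ξ) * ∑ m ∈ Finset.range N, ∑ i ∈ Finset.range m, ξ ^ i = N := by
  have h0 : ∑ m ∈ Finset.range N, ξ ^ m = 0 := by rw [geom_sum_eq h1, hN]; simp
  have h (m : ℕ) : (1 - ξ) * ∑ i ∈ Finset.range m, ξ ^ i = 1 - ξ ^ m := by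
    rw [mul_comm, geom_sum_mul_neg]
  rw [Finset.mul_sum, Finset.sum_congr rfl fun m _ => h m, Finset.sum_sub_distrib, h0]
  simp

/-- The averaging construction. A composition `x` close to `e^{h d A} k`, with `k` of leading term
`c z hⁿ`, is rotated by all `N`-th roots of unity `ζᵐ`, conjugated by `e^{h uₘ B}` with
`uₘ = w d ζ^{-mj}`, and multiplied up. The sum over `m` cancels the terms in `hⁿ` and the
uncontrolled Lie terms in `hⁿ⁺¹`; what remains comes from the noncommutativity of the factors. -/
lemma flexible_average {n : ℕ} (hn : 2 ≤ n) (hR : Reachable n) {l : List (Fin 2)}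
    (hl : l.length = n) {ζ : ℂ} (hζ : IsPrimitiveRoot ζ (n + 2)) (hj : l.count 1 ≠ 0) (w : ℂ) :
    Flexible n (Submodule.span ℂ {(((n + 2 : ℕ) : ℂ) * w) • ⁅letterB, nested l⁆ -
      (∑ m ∈ Finset.range (n + 2), ∑ i ∈ Finset.range m, (ζ ^ l.count 1) ^ i) •
        ⁅letterA, nested l⁆}) := by
  intro ε hε
  set N := n + 2 with hN
  set ξ : ℂ := ζ ^ l.count 1 with hξ
  have hlN : l.count 1 < N := List.count_le_length.trans_lt (by omega)
  have hξ1 : ξ ≠ 1 := hζ.pow_ne_one_of_pos_of_lt hj hlN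
  have hξN : ξ ^ N = 1 := by rw [hξ, ← pow_mul, mul_comm, pow_mul, hζ.pow_eq_one, one_pow]
  have hξ0 : ξ ≠ 0 := pow_ne_zero _ (hζ.ne_zero (by omega))
  have hNpos : (0 : ℝ) < N := by positivity
  obtain ⟨d, hd, hdε⟩ : ∃ d : ℝ, 0 < d ∧ N * d < ε :=
    ⟨ε / (2 * N), by positivity, by field_simp; linarith⟩
  have hd0 : (d : ℂ) ≠ 0 := by exact_mod_cast hd.ne'
  set E : (PowerSeries Words)ˣ := expUnit ((d : ℂ) • letterA) with hE
  have hEL : E ∈ lieGroup := expA_mem_lieGroup _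
  have hE1 : coeff 1 (E : PowerSeries Words) = (d : ℂ) • letterA := coeff_one_formalExp _
  set F : ℕ → (PowerSeries Words)ˣ := fun m => expUnit ((w * d * (ξ ^ m)⁻¹) • letterB) with hF
  have hFL (m : ℕ) : F m ∈ lieGroup := expB_mem_lieGroup _
  set g : ℕ → (PowerSeries Words)ˣ := fun m => F m * E * (F m)⁻¹ with hg
  have hgL (m : ℕ) : g m ∈ lieGroup := mul_mem (mul_mem (hFL m) hEL) (inv_mem (hFL m))
  have hg0 (m : ℕ) := coeff_zero_of_mem (hgL m)
  have hg1 (m : ℕ) : coeff 1 (g m : PowerSeries Words) = (d : ℂ) • letterA := by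
    simp only [hg, Units.val_mul, coeff_one_mul', coeff_zero_mul, coeff_one_inv
      (coeff_zero_of_mem (hFL m)), coeff_zero_of_mem (hFL m), coeff_zero_of_mem hEL, hE1,
      coeff_zero_of_mem (inv_mem (hFL m)), mul_one, one_mul]
    abel
  have hG := coeff_prod_of_const hg0 hg1 N
  set G := ((List.range N).map g).prod with hGdef
  have hGL : G ∈ lieGroup := Subgroup.list_prod_mem _ fun y hy => by
    obtain ⟨m, -, rfl⟩ := List.mem_map.1 hy
    exact hgL m
  refine ⟨G, hGL, N * d, by positivity, hdε, ?_, fun v hv => ?_⟩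
  · rw [hG.2, ← Nat.cast_smul_eq_nsmul ℂ, smul_smul]
    push_cast
    rfl
  obtain ⟨c, rfl⟩ := Submodule.mem_span_singleton.1 hv
  -- The leading coefficient is scaled by `d⁻¹` to compensate for the factor `d` of the commutators.
  obtain ⟨k, hkL, hk1, hkn⟩ := exists_leading_nested (c / d) (l := l)
    (by rintro rfl; simp at hj)
  rw [hl] at hk1 hkn
  obtain ⟨x, hx, hxk⟩ := hR (E * k) (mul_mem hEL hkL) d 0 hd (by
    rw [Units.val_mul, coeff_one_mul', coeff_zero_of_mem hkL, hE1, hk1 1 (by omega)]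
    simp [coeff_one])
  set q := E⁻¹ * x with hq
  have hqk : Agree (n + 1) (q : PowerSeries Words) k := by
    have := (Agree.refl (n + 1) ((E⁻¹ : (PowerSeries Words)ˣ) : PowerSeries Words)).mul hxk
    rwa [← Units.val_mul, ← Units.val_mul, inv_mul_cancel_left] at this
  have hq1 : Agree n (q : PowerSeries Words) 1 := (hqk.mono n.le_succ).trans hk1
  have hqn : coeff n (q : PowerSeries Words) = (c / d) • nested l :=
    (hqk n n.lt_succ_self).trans hkn
  have hqL := coeff_succ_mem_liePart hn (mul_mem (inv_mem hEL) (methods_le_lieGroup hx)) hq1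
  have hρ1 (m : ℕ) : Agree n (rotateUnit (ζ ^ m) q : PowerSeries Words) 1 := by
    intro i hi
    rw [coeff_rotateUnit, hq1 i hi, coeff_one]
    split_ifs <;> simp
  have hρn (m : ℕ) : coeff n (rotateUnit (ζ ^ m) q : PowerSeries Words) =
      (c / d * ξ ^ m) • nested l := by
    rw [coeff_rotateUnit, hqn, map_smul, rotate_nested, smul_smul, hξ, ← pow_mul, ← pow_mul,
      mul_comm m]
  set r : ℕ → (PowerSeries Words)ˣ := fun m => F m * rotateUnit (ζ ^ m) q * (F m)⁻¹ with hr
  have hlead (m : ℕ) := conj_leading (hρ1 m) (coeff_zero_of_mem (hFL m)) (by omega)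
  obtain ⟨Q, hQ, hQ1, hQn, hQs⟩ := prod_leading hn hg0 hg1 (fun m => (hlead m).1) N
  have hrn (m : ℕ) : coeff n (r m : PowerSeries Words) = (c / d * ξ ^ m) • nested l :=
    (hlead m).2.1.trans (hρn m)
  have hrs (m : ℕ) : coeff (n + 1) (r m : PowerSeries Words) =
      rotate (ζ ^ m) (coeff (n + 1) (q : PowerSeries Words)) +
        (w * c) • ⁅letterB, nested l⁆ := by
    have hξm : ξ ^ m ≠ 0 := pow_ne_zero _ hξ0
    rw [(hlead m).2.2, hρn, coeff_rotateUnit, hF, val_expUnit, coeff_one_formalExp,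
      smul_commutator, commutator_smul, smul_smul]
    congr 2
    field_simp
  have hQn' : coeff n (Q : PowerSeries Words) = 0 := by
    rw [hQn, Finset.sum_congr rfl fun m _ => hrn m, ← Finset.sum_smul, ← Finset.mul_sum,
      geom_sum_eq hξ1, hξN]
    simp
  have hQ1' : Agree (n + 1) (Q : PowerSeries Words) 1 :=
    hQ1.succ (by rw [hQn', coeff_one, if_neg (by omega)])
  have hQs' : coeff (n + 1) (Q : PowerSeries Words) =
      c • (((N : ℂ) * w) • ⁅letterB, nested l⁆ -
        (∑ m ∈ Finset.range N, ∑ i ∈ Finset.range m, ξ ^ i) • ⁅letterA, nested l⁆) := by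
    have hlie (m : ℕ) : ⁅(d : ℂ) • letterA, ∑ i ∈ Finset.range m, coeff n (r i : PowerSeries Words)⁆
        = (c * ∑ i ∈ Finset.range m, ξ ^ i) • ⁅letterA, nested l⁆ := by
      simp_rw [hrn]
      rw [← Finset.sum_smul, ← Finset.mul_sum, smul_commutator, commutator_smul, smul_smul]
      congr 1
      field_simp
    rw [hQs, Finset.sum_sub_distrib, Finset.sum_congr rfl fun m _ => hlie m,
      Finset.sum_congr rfl fun m _ => hrs m, Finset.sum_add_distrib,
      sum_rotate_eq_zero hζ (by omega) (by omega) hqL,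
      Finset.sum_const, Finset.card_range, ← Finset.sum_smul, ← Finset.mul_sum, zero_add, smul_sub,
      ← Nat.cast_smul_eq_nsmul ℂ, smul_smul, smul_smul, smul_smul]
    congr 2
    ring
  refine ⟨((List.range N).map fun m => g m * r m).prod,
    Submonoid.list_prod_mem _ fun y hy => ?_, ?_, ?_⟩
  · obtain ⟨m, -, rfl⟩ := List.mem_map.1 hy
    have : g m * r m = F m * rotateUnit (ζ ^ m) x * (F m)⁻¹ := by
      have hxq : rotateUnit (ζ ^ m) x = E * rotateUnit (ζ ^ m) q := by
        rw [hq, map_mul, map_inv, hE, rotateUnit_expA, mul_inv_cancel_left]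
      rw [hxq, hg, hr]
      group
    rw [this]
    exact expB_conj_mem_methods _ (rotateUnit_mem_methods _ hx)
  · rw [hQ, Units.val_mul]
    simpa using (Agree.refl (n + 1) (G : PowerSeries Words)).mul hQ1'
  · rw [hQ, Units.val_mul]
    have := coeff_mul_sub_coeff_mul n.succ_ne_zero (Agree.refl (n + 1) (G : PowerSeries Words)) hQ1'
      hG.1 (by rw [hQ1' 0 (by omega), coeff_zero_one])
    rw [mul_one] at this
    rw [this, hQs', coeff_one, if_neg n.succ_ne_zero]
    simp

lemma flexible_of_reachable {n : ℕ} (hn : 2 ≤ n) (hR : Reachable n) :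
    Flexible n (liePart (n + 1)) := by
  refine flexible_liePart fun l' hl' => ?_
  obtain ⟨i, l, rfl⟩ : ∃ i l, l' = i :: l := List.exists_cons_of_length_eq_add_one hl'
  have hl : l.length = n := by simpa using hl'
  rw [nested_cons i (by rintro rfl; simp at hl; omega)]
  by_cases hj : l.count 1 = 0
  · rw [nested_eq_zero (by omega) hj, commutator_zero, Submodule.span_zero_singleton]
    exact flexible_bot n
  obtain ⟨ζ, hζ⟩ : ∃ ζ : ℂ, IsPrimitiveRoot ζ (n + 2) :=
    ⟨_, Complex.isPrimitiveRoot_exp (n + 2) (by omega)⟩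
  have hlN : l.count 1 < n + 2 := List.count_le_length.trans_lt (by omega)
  set κ := ∑ m ∈ Finset.range (n + 2), ∑ i ∈ Finset.range m, (ζ ^ l.count 1) ^ i with hκdef
  have hκ : κ ≠ 0 := by
    have := one_sub_mul_sum_geom_sum (hζ.pow_ne_one_of_pos_of_lt hj hlN) (N := n + 2)
      (by rw [← pow_mul, mul_comm, pow_mul, hζ.pow_eq_one, one_pow])
    rw [← hκdef] at this
    intro h
    rw [h, mul_zero] at this
    exact (Nat.cast_ne_zero.2 (by omega : n + 2 ≠ 0)) this.symm
  -- `w = 0` yields `[A, z]`; subtracting it from the case `w = 1` yields `[B, z]`.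
  refine ((flexible_average hn hR hl hζ hj 0).sup (flexible_average hn hR hl hζ hj 1)).mono ?_
  rw [← hκdef, Submodule.span_singleton_le_iff_mem]
  set a := ⁅letterA, nested l⁆
  set b := ⁅letterB, nested l⁆
  set W := Submodule.span ℂ {(((n + 2 : ℕ) : ℂ) * 0) • b - κ • a} ⊔
    Submodule.span ℂ {(((n + 2 : ℕ) : ℂ) * 1) • b - κ • a} with hW
  have h0 : (((n + 2 : ℕ) : ℂ) * 0) • b - κ • a ∈ W :=
    Submodule.mem_sup_left (Submodule.mem_span_singleton_self _)
  have h1 : (((n + 2 : ℕ) : ℂ) * 1) • b - κ • a ∈ W :=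
    Submodule.mem_sup_right (Submodule.mem_span_singleton_self _)
  have ha : κ • a ∈ W := by simpa using h0
  have hb : ((n + 2 : ℕ) : ℂ) • b ∈ W := by simpa using add_mem h1 ha
  rw [Submodule.smul_mem_iff _ hκ] at ha
  rw [Submodule.smul_mem_iff _ (Nat.cast_ne_zero.2 (by omega))] at hb
  fin_cases i
  exacts [ha, hb]

/-! ### Existence of methods of every order -/

theorem reachable {n : ℕ} (hn : 1 ≤ n) : Reachable n := by
  induction n, hn using Nat.le_induction with
  | base => exact reachable_one
  | succ n hn ih =>
    refine ih.succ ?_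
    rcases hn.eq_or_lt with rfl | hn
    exacts [flexible_one, flexible_of_reachable hn ih]

/-- No upper bound on the order is needed. -/
theorem exists_hasOrder {p : ℕ} (hp : 1 ≤ p) :
    ∃ (s : ℕ) (a : Fin s → ℂ) (b : Fin (s + 1) → ℂ),
      (∀ i, 0 ≤ (a i).re) ∧ HasOrder a b p := by
  obtain ⟨x, hx, hxg⟩ := reachable hp (expUnit (letterA + letterB))
    (expUnit_mem_lieGroup (add_mem letterA_mem_liePart letterB_mem_liePart)) 1 1 one_pos
    (by rw [val_expUnit, coeff_one_formalExp]; simp)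
  obtain ⟨s, a, b, ha, hab⟩ := exists_method_eq hx
  refine ⟨s, a, b, ha, fun k hk => ?_⟩
  rw [hab, map_sub, hxg k (by omega), val_expUnit, sub_self]

end Splitting

end

theorem theorem2p4 (p : ℕ) (hp : 1 ≤ p) (hp44 : p ≤ 44) :
    ∃ (s : ℕ) (a : Fin s → ℂ) (b : Fin (s + 1) → ℂ),
      (∀ i, 0 ≤ (a i).re) ∧ Splitting.HasOrder a b p :=
  Splitting.exists_hasOrder hp
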